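/- Let $G$ be a complex Lie group (finite-dimensional), let $\sigma : G \to G$ be an antiholomorphic involution, i.e. an involutive automorphism of the group $G$ that is smooth for the underlying real Lie group structure and has complex-antilinear differential at every point, and let $H \subset G$ be a closed complex Lie subgroup. Equip the homogeneous space $X = G/H$ with its quotient complex manifold structure and with the action of $G$ by left translations. A $\sigma$-equivariant real structure on $X$ is an antiholomorphic diffeomorphism $\mu : X \to X$ such that $\mu \circ \mu = \mathrm{id}_X$ and $$\mu(g \cdot x) = \sigma(g) \cdot \mu(x) \quad \text{for all } g \in G,\ x \in X.$$ (1) If there exists a $\sigma$-equivariant real structure on $X$, then $\sigma(H)$ and $H$ are conjugate by an inner automorphism of $G$, i.e. $\sigma(H) = g_0 H g_0^{-1}$ for some $g_0 \in G$. (2) Conversely, if $\sigma(H) = g_0 H g_0^{-1}$ for some $g_0 \in G$ and $H$ is self-normalizing, i.e. $N_G(H) = H$, then there exists one and only one $\sigma$-equivariant real structure on $X$. -/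

import Mathlib

open scoped Manifold ContDiff Topology

noncomputable section

section Antiholomorphic

/-- The differential at `x` of a map between complex manifolds, as a real linear map between the
complex model spaces, which are identified with the tangent spaces through the preferred
holomorphic charts at `x` and at `f x`. -/
def realDifferential (E F : Type*) [NormedAddCommGroup E] [NormedSpace ℂ E]
    [NormedAddCommGroup F] [NormedSpace ℂ F]
    {M N : Type*} [TopologicalSpace M] [ChartedSpace E M] [TopologicalSpace N] [ChartedSpace F N]
    (f : M → N) (x : M) : E →L[ℝ] F :=
  mfderiv 𝓘(ℝ, E) 𝓘(ℝ, F) f x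

/-- A map between complex manifolds is antiholomorphic if it is smooth as a map of the underlying
real manifolds and its differential is antilinear with respect to the complex structures of the
tangent spaces. -/
def IsAntiholomorphic (E F : Type*) [NormedAddCommGroup E] [NormedSpace ℂ E]
    [NormedAddCommGroup F] [NormedSpace ℂ F]
    {M N : Type*} [TopologicalSpace M] [ChartedSpace E M] [TopologicalSpace N] [ChartedSpace F N]
    (f : M → N) : Prop :=
  ContMDiff 𝓘(ℝ, E) 𝓘(ℝ, F) ∞ f ∧
    ∀ (x : M) (v : E), realDifferential E F f x (Complex.I • v) =
      -(Complex.I • realDifferential E F f x v)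

/-- A real structure on a complex manifold: an antiholomorphic involutive diffeomorphism.
(A smooth involution is its own smooth inverse, hence a diffeomorphism.) -/
structure IsRealStructure (F : Type*) [NormedAddCommGroup F] [NormedSpace ℂ F]
    {X : Type*} [TopologicalSpace X] [ChartedSpace F X] (μ : X → X) : Prop where
  antiholomorphic : IsAntiholomorphic F F μ
  involutive : Function.Involutive μ

/-- A real structure `μ` on `X` that is compatible with a group action and `σ : G → G`. -/
structure IsEquivariantRealStructure (F : Type*) [NormedAddCommGroup F] [NormedSpace ℂ F]
    {G : Type*} [Group G] (σ : G →* G)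
    {X : Type*} [TopologicalSpace X] [ChartedSpace F X] [MulAction G X] (μ : X → X) : Prop
    extends IsRealStructure F μ where
  equivariant : ∀ (g : G) (x : X), μ (g • x) = σ g • μ x

end Antiholomorphic

section Quotient

variable {E : Type*} [NormedAddCommGroup E] [NormedSpace ℂ E]
variable {G : Type*} [Group G] [TopologicalSpace G] [ChartedSpace E G]

/-- A closed complex Lie subgroup: a closed subgroup which is a complex submanifold, i.e. around
each of its points there is a holomorphic chart of `G` in which it is a complex linear subspace. -/
structure IsClosedComplexLieSubgroup (E : Type*) [NormedAddCommGroup E] [NormedSpace ℂ E]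
    {G : Type*} [Group G] [TopologicalSpace G] [ChartedSpace E G] (H : Subgroup G) : Prop where
  isClosed : IsClosed (H : Set G)
  exists_slice : ∀ h ∈ H, ∃ e ∈ IsManifold.maximalAtlas 𝓘(ℂ, E) ω G, ∃ W : Submodule ℂ E,
    h ∈ e.source ∧ ∀ x ∈ e.source, x ∈ H ↔ e x ∈ W

variable [FiniteDimensional ℂ E] [LieGroup 𝓘(ℂ, E) ω G] {H : Subgroup G}

/-- Near the identity a holomorphic slice transversal to `H` is given by `s`, and `p` is the
holomorphic projection to the slice along the cosets of `H`. -/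
theorem IsClosedComplexLieSubgroup.exists_section (hH : IsClosedComplexLieSubgroup E H) :
    ∃ (V : Submodule ℂ E) (A : Set V) (N : Set G) (s : V → G) (p : G → V),
      IsOpen A ∧ 0 ∈ A ∧ IsOpen N ∧ s 0 = 1 ∧ Set.MapsTo s A N ∧
      ContMDiffOn 𝓘(ℂ, V) 𝓘(ℂ, E) ω s A ∧ ContMDiffOn 𝓘(ℂ, E) 𝓘(ℂ, V) ω p N ∧
      Set.InjOn (fun v => (s v : G ⧸ H)) A ∧
      (∀ g ∈ N, (s (p g) : G ⧸ H) = (g : G ⧸ H)) ∧ (∀ v ∈ A, p (s v) = v) := by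
  have : IsTopologicalGroup G := topologicalGroup_of_lieGroup 𝓘(ℂ, E) ω
  have : CompleteSpace E := FiniteDimensional.complete ℂ E
  obtain ⟨e, he, W, h1, hW⟩ := hH.exists_slice 1 H.one_mem
  obtain ⟨V, hVW⟩ := W.exists_isCompl
  have hWV : IsCompl V W := hVW.symm
  have : CompleteSpace V := FiniteDimensional.complete ℂ V
  have : CompleteSpace W := FiniteDimensional.complete ℂ W
  set w0 : E := e 1 with hw0
  have hw0W : w0 ∈ W := (hW 1 h1).1 H.one_mem
  have hw0t : w0 ∈ e.target := e.map_source h1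
  have hes : e.symm w0 = 1 := e.left_inv h1
  let S : E → G := fun v => e.symm (w0 + v)
  have hS0 : S 0 = 1 := by simp [S, hes]
  have hTopen : IsOpen {v : E | w0 + v ∈ e.target} :=
    e.open_target.preimage (continuous_const.add continuous_id)
  have hSsm : ContMDiffOn 𝓘(ℂ, E) 𝓘(ℂ, E) ω S {v : E | w0 + v ∈ e.target} :=
    (contMDiffOn_symm_of_mem_maximalAtlas he).comp
      ((contDiff_const.add contDiff_id).contMDiff.contMDiffOn) (fun v hv => hv)
  have hSat : ContMDiffAt 𝓘(ℂ, E) 𝓘(ℂ, E) ω S 0 :=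
    hSsm.contMDiffAt (hTopen.mem_nhds (by simpa using hw0t))
  have heS : ∀ v, w0 + v ∈ e.target → e (S v) = w0 + v := fun v hv => e.right_inv hv
  have hSsrc : ∀ v, w0 + v ∈ e.target → S v ∈ e.source := fun v hv => e.map_target hv
  have hSW : ∀ w : W, w0 + w ∈ e.target → S w ∈ H := fun w hw => by
    rw [hW _ (hSsrc _ hw), heS _ hw]; exact W.add_mem hw0W w.2
  let m : V × W → G := fun q => S q.1 * S q.2
  have hfst : ContMDiffAt 𝓘(ℂ, V × W) 𝓘(ℂ, E) ω (fun q : V × W => (q.1 : E)) 0 :=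
    (V.subtypeL.contDiff.comp contDiff_fst).contMDiff.contMDiffAt
  have hsnd : ContMDiffAt 𝓘(ℂ, V × W) 𝓘(ℂ, E) ω (fun q : V × W => (q.2 : E)) 0 :=
    (W.subtypeL.contDiff.comp contDiff_snd).contMDiff.contMDiffAt
  have hm : ContMDiffAt 𝓘(ℂ, V × W) 𝓘(ℂ, E) ω m 0 :=
    (ContMDiffAt.comp (g := S) (0 : V × W) (by simpa using hSat) hfst).mul
      (ContMDiffAt.comp (g := S) (0 : V × W) (by simpa using hSat) hsnd)
  have hm0 : m 0 = 1 := by simp [m, hS0]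
  let F : V × W → E := fun q => e (m q)
  have hF : ContDiffAt ℂ ω F 0 := by
    rw [← contMDiffAt_iff_contDiffAt]
    exact ContMDiffAt.comp (g := e) (0 : V × W)
      (contMDiffAt_of_mem_maximalAtlas he (by rw [hm0]; exact h1)) hm
  have hF0 : F 0 = w0 := by simp [F, hm0, hw0]
  -- `F` on the two factors
  have hFv : ∀ v : V, w0 + (v : E) ∈ e.target → F (v, 0) = w0 + v := fun v hv => by
    simp [F, m, hS0, heS _ hv]
  have hFw : ∀ w : W, w0 + (w : E) ∈ e.target → F (0, w) = w0 + w := fun w hw => by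
    simp [F, m, hS0, heS _ hw]
  have hFd : HasFDerivAt F (fderiv ℂ F 0) 0 := (hF.differentiableAt (by simp)).hasFDerivAt
  have hdv : ∀ v : V, fderiv ℂ F 0 (v, 0) = v := by
    have h1' : HasFDerivAt (fun v : V => F (v, 0))
        ((fderiv ℂ F 0).comp (ContinuousLinearMap.inl ℂ V W)) 0 :=
      HasFDerivAt.comp (g := F) (f := fun v : V => ((v, 0) : V × W)) (0 : V) hFd
        (ContinuousLinearMap.inl ℂ V W).hasFDerivAt
    have h2' : HasFDerivAt (fun v : V => F (v, 0)) V.subtypeL 0 := by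
      refine (V.subtypeL.hasFDerivAt.const_add w0).congr_of_eventuallyEq ?_
      filter_upwards [(hTopen.preimage V.subtypeL.continuous).mem_nhds
        (show (0 : V) ∈ _ by simpa using hw0t)] with v hv
      exact hFv v hv
    intro v
    simpa using congrArg (fun L : V →L[ℂ] E => L v) (h1'.unique h2')
  have hdw : ∀ w : W, fderiv ℂ F 0 (0, w) = w := by
    have h1' : HasFDerivAt (fun w : W => F (0, w))
        ((fderiv ℂ F 0).comp (ContinuousLinearMap.inr ℂ V W)) 0 :=
      HasFDerivAt.comp (g := F) (f := fun w : W => ((0, w) : V × W)) (0 : W) hFd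
        (ContinuousLinearMap.inr ℂ V W).hasFDerivAt
    have h2' : HasFDerivAt (fun w : W => F (0, w)) W.subtypeL 0 := by
      refine (W.subtypeL.hasFDerivAt.const_add w0).congr_of_eventuallyEq ?_
      filter_upwards [(hTopen.preimage W.subtypeL.continuous).mem_nhds
        (show (0 : W) ∈ _ by simpa using hw0t)] with w hw
      exact hFw w hw
    intro w
    simpa using congrArg (fun L : W →L[ℂ] E => L w) (h1'.unique h2')
  let L : (V × W) ≃L[ℂ] E := (V.prodEquivOfIsCompl W hWV).toContinuousLinearEquiv
  have hL : (L : V × W →L[ℂ] E) = fderiv ℂ F 0 := by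
    ext q
    · simpa [L] using (hdv _).symm
    · simpa [L] using (hdw _).symm
  have hFL : HasFDerivAt F (L : V × W →L[ℂ] E) 0 := by rw [hL]; exact hFd
  let Φ := hF.toOpenPartialHomeomorph F hFL (by simp)
  have hΦ0 : (0 : V × W) ∈ Φ.source := hF.mem_toOpenPartialHomeomorph_source hFL (by simp)
  have hΦc : ∀ q, Φ q = F q := fun q => rfl
  have hΦt : w0 ∈ Φ.target := by have := Φ.map_source hΦ0; rwa [hΦc, hF0] at this
  have hΦs0 : Φ.symm w0 = 0 := by have := Φ.left_inv hΦ0; rwa [hΦc, hF0] at this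
  have hΦsm : ContDiffAt ℂ ω Φ.symm w0 := by
    have := hF.to_localInverse hFL (by simp)
    rw [hF0] at this
    exact this
  -- neighbourhoods for the projection
  have hp_ev : ∀ᶠ g in 𝓝 (1 : G), g ∈ e.source ∧ e g ∈ Φ.target ∧
      ContDiffAt ℂ ω Φ.symm (e g) ∧
      w0 + ((Φ.symm (e g)).2 : E) ∈ e.target ∧ m (Φ.symm (e g)) ∈ e.source := by
    have hec : Filter.Tendsto e (𝓝 1) (𝓝 w0) := e.continuousAt h1
    have hΦec : Filter.Tendsto (fun g => Φ.symm (e g)) (𝓝 1) (𝓝 0) := by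
      have := (hΦsm.continuousAt.tendsto).comp hec
      rwa [hΦs0] at this
    refine Filter.Eventually.and (e.open_source.mem_nhds h1) ((hec.eventually (Φ.open_target.mem_nhds hΦt)).and
      ((hec.eventually (hΦsm.eventually (by simp))).and (.and ?_ ?_)))
    · exact hΦec.eventually ((hTopen.preimage
        (W.subtypeL.continuous.comp continuous_snd)).mem_nhds (by simpa using hw0t))
    · have := hm.continuousAt.tendsto.comp hΦec
      rw [hm0] at this
      exact this.eventually (e.open_source.mem_nhds h1)
  obtain ⟨N0, hN0, hN0o, h1N0⟩ := eventually_nhds_iff.1 hp_ev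
  let p : G → V := fun g => (Φ.symm (e g)).1
  have hp1 : p 1 = 0 := by simp [p, ← hw0, hΦs0]
  let s : V → G := fun v => S v
  have hs0 : s 0 = 1 := hS0
  have hpN0 : ContMDiffOn 𝓘(ℂ, E) 𝓘(ℂ, V) ω p N0 := by
    intro g hg
    obtain ⟨hg1, -, hg3, -, -⟩ := hN0 g hg
    have : ContMDiffAt 𝓘(ℂ, E) 𝓘(ℂ, V) ω (fun x : E => (Φ.symm x).1) (e g) :=
      (contDiff_fst.contDiffAt.comp _ hg3).contMDiffAt
    exact (this.comp g (contMDiffAt_of_mem_maximalAtlas he hg1)).contMDiffWithinAt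
  have hsp : ∀ g ∈ N0, (s (p g) : G ⧸ H) = (g : G ⧸ H) := by
    intro g hg
    obtain ⟨hg1, hg2, -, hg4, hg5⟩ := hN0 g hg
    have h : m (Φ.symm (e g)) = g := e.injOn hg5 hg1 (Φ.right_inv hg2)
    rw [QuotientGroup.eq]
    have hk : (s (p g))⁻¹ * g = S (Φ.symm (e g)).2 := by
      rw [inv_mul_eq_iff_eq_mul]
      exact h.symm
    rw [hk]
    exact hSW _ hg4
  -- injectivity
  obtain ⟨ε, hε, hball⟩ := Metric.isOpen_iff.1 Φ.open_source 0 hΦ0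
  have hsc : ContinuousAt s 0 := by
    have : ContinuousAt S ((0 : V) : E) := by simpa using hSat.continuousAt
    exact this.comp (f := fun v : V => (v : E)) continuous_subtype_val.continuousAt
  have hinj_ev : ∀ᶠ q : V × V in 𝓝 (0, 0), (s q.1)⁻¹ * s q.2 ∈ e.source ∧
      ‖e ((s q.1)⁻¹ * s q.2) - w0‖ < ε := by
    have hc : Filter.Tendsto (fun q : V × V => (s q.1)⁻¹ * s q.2) (𝓝 (0, 0)) (𝓝 1) := by
      have h1' : ContinuousAt (fun q : V × V => s q.1) (0, 0) :=
        ContinuousAt.comp (g := s) (by exact hsc) continuousAt_fst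
      have h2' : ContinuousAt (fun q : V × V => s q.2) (0, 0) :=
        ContinuousAt.comp (g := s) (by exact hsc) continuousAt_snd
      have := (h1'.inv.mul h2').tendsto
      rw [show ((fun q : V × V => s q.1)⁻¹ * fun q : V × V => s q.2) (0, 0) = 1 by
        simp [hs0]] at this
      exact this
    refine (hc.eventually (e.open_source.mem_nhds h1)).and ?_
    have := (e.continuousAt h1).tendsto.comp hc
    have h3 := this.eventually (Metric.ball_mem_nhds _ hε)
    filter_upwards [h3] with q hq
    simpa [dist_eq_norm] using hq
  obtain ⟨A1, hA1, A2, hA2, hA12⟩ := mem_nhds_prod_iff.1 hinj_ev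
  have hA0ev : ∀ᶠ v : V in 𝓝 0, v ∈ A1 ∧ v ∈ A2 ∧ ‖v‖ < ε ∧ w0 + (v : E) ∈ e.target := by
    refine Filter.Eventually.and hA1 (Filter.Eventually.and hA2 (.and ?_ ?_))
    · filter_upwards [Metric.ball_mem_nhds (0 : V) hε] with v hv
      simpa using hv
    · exact (hTopen.preimage V.subtypeL.continuous).mem_nhds (by simpa using hw0t)
  obtain ⟨A0, hA0, hA0o, h0A0⟩ := eventually_nhds_iff.1 hA0ev
  have hinj : Set.InjOn (fun v => (s v : G ⧸ H)) A0 := by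
    intro v hv v' hv' hvv
    have hh : (s v)⁻¹ * s v' ∈ H := QuotientGroup.eq.1 hvv
    obtain ⟨hv1, hv2, hv3, hv4⟩ := hA0 v hv
    obtain ⟨hv1', hv2', hv3', hv4'⟩ := hA0 v' hv'
    obtain ⟨hsrc, hnorm⟩ := hA12 (show (v, v') ∈ A1 ×ˢ A2 from ⟨hv1, hv2'⟩)
    simp only at hsrc hnorm
    let w : W := ⟨e ((s v)⁻¹ * s v') - w0, W.sub_mem ((hW _ hsrc).1 hh) hw0W⟩
    have hSw : S w = (s v)⁻¹ * s v' := by simp [S, w, e.left_inv hsrc]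
    have e1 : F (v, w) = F (v', 0) := by
      have : m (v, w) = m (v', 0) := by
        change S v * S w = S v' * S ((0 : W) : E)
        rw [hSw]
        simp [s, hS0]
      simp only [F, this]
    have s1 : (v, w) ∈ Φ.source := by
      apply hball
      rw [mem_ball_zero_iff, Prod.norm_def]
      exact max_lt hv3 hnorm
    have s2 : (v', (0 : W)) ∈ Φ.source := by
      apply hball
      rw [mem_ball_zero_iff, Prod.norm_def]
      exact max_lt hv3' (by simpa using hε)
    exact congrArg Prod.fst (Φ.injOn s1 s2 e1)
  -- shrink
  let N : Set G := N0 ∩ p ⁻¹' A0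
  have hN : IsOpen N := hpN0.continuousOn.isOpen_inter_preimage hN0o hA0o
  have hsA0 : ContMDiffOn 𝓘(ℂ, V) 𝓘(ℂ, E) ω s A0 :=
    hSsm.comp (V.subtypeL.contDiff.contMDiff.contMDiffOn) (fun v hv => (hA0 v hv).2.2.2)
  refine ⟨V, A0 ∩ s ⁻¹' N, N, s, p, hsA0.continuousOn.isOpen_inter_preimage hA0o hN,
    ⟨h0A0, ?_⟩, hN, hs0, fun v hv => hv.2, hsA0.mono Set.inter_subset_left,
    hpN0.mono Set.inter_subset_left, hinj.mono Set.inter_subset_left,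
    fun g hg => hsp g hg.1, fun v hv => hinj hv.2.2 hv.1 (hsp _ hv.2.1)⟩
  change s 0 ∈ N
  rw [hs0]
  exact ⟨h1N0, by simpa [hp1] using h0A0⟩

/-- A chart of `G ⧸ H` around the base point, holomorphic after composition with the projection
`G → G ⧸ H`, whose inverse lifts to a holomorphic map to `G`. -/
theorem IsClosedComplexLieSubgroup.exists_chart (hH : IsClosedComplexLieSubgroup E H) :
    ∃ (V : Submodule ℂ E) (φ : OpenPartialHomeomorph (G ⧸ H) V) (s : V → G),
      ((1 : G) : G ⧸ H) ∈ φ.source ∧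
      ContMDiffOn 𝓘(ℂ, E) 𝓘(ℂ, V) ω (fun g : G => φ (g : G ⧸ H))
        ((fun g : G => (g : G ⧸ H)) ⁻¹' φ.source) ∧
      ContMDiffOn 𝓘(ℂ, V) 𝓘(ℂ, E) ω s φ.target ∧
      ∀ v ∈ φ.target, φ.symm v = (s v : G ⧸ H) := by
  have : IsTopologicalGroup G := topologicalGroup_of_lieGroup 𝓘(ℂ, E) ω
  obtain ⟨V, A, N, s, p, hA, h0, hN, hs0, hsN, hs, hp, hinj, hsp, hps⟩ := hH.exists_section
  have hcont : ContinuousOn (fun v => (s v : G ⧸ H)) A :=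
    QuotientGroup.continuous_mk.comp_continuousOn hs.continuousOn
  have hopen : IsOpenMap (A.domRestrict (fun v => (s v : G ⧸ H))) := by
    rw [isOpenMap_iff_nhds_le]
    rintro ⟨v, hv⟩ U hU
    rw [Filter.mem_map, nhds_subtype_eq_comap, Filter.mem_comap] at hU
    obtain ⟨B, hB, hBU⟩ := hU
    have hpc : ContinuousAt p (s v) :=
      (hp.continuousOn).continuousAt (hN.mem_nhds (hsN hv))
    have hBA : p ⁻¹' (B ∩ A) ∩ N ∈ 𝓝 (s v) := by
      refine Filter.inter_mem (hpc.preimage_mem_nhds ?_) (hN.mem_nhds (hsN hv))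
      rw [hps v hv]
      exact Filter.inter_mem hB (hA.mem_nhds hv)
    have := QuotientGroup.isOpenMap_coe (N := H) |>.image_mem_nhds hBA
    refine Filter.mem_of_superset this ?_
    rintro _ ⟨g, ⟨⟨hg1, hg2⟩, hg3⟩, rfl⟩
    have := hBU (show (⟨p g, hg2⟩ : A) ∈ _ from hg1)
    simp only [Set.mem_preimage, Set.domRestrict_apply] at this
    rwa [hsp g hg3] at this
  let ψ : OpenPartialHomeomorph V (G ⧸ H) :=
    OpenPartialHomeomorph.ofContinuousOpenRestrict (hinj.toPartialEquiv _ A) hcont hopen hA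
  have hψ : ∀ v, ψ v = (s v : G ⧸ H) := fun v => rfl
  have hψs : ψ.source = A := rfl
  refine ⟨V, ψ.symm, s, ?_, ?_, ?_, fun v _ => hψ v⟩
  · have := ψ.map_source (x := 0) h0
    rwa [hψ, hs0] at this
  · intro g hg
    have hv : ψ.symm (g : G ⧸ H) ∈ A := ψ.map_target hg
    set v := ψ.symm (g : G ⧸ H) with hvdef
    have hgv : (s v : G ⧸ H) = g := ψ.right_inv hg
    have hh : (s v)⁻¹ * g ∈ H := QuotientGroup.eq.1 hgv
    set h := (s v)⁻¹ * g with hdef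
    have hgh : g * h⁻¹ = s v := by simp [hdef]
    have hr : ContMDiffAt 𝓘(ℂ, E) 𝓘(ℂ, E) ω (fun x : G => x * h⁻¹) g :=
      (contMDiff_mul_right (a := h⁻¹)).contMDiffAt
    have hq : ContMDiffAt 𝓘(ℂ, E) 𝓘(ℂ, V) ω (fun x : G => p (x * h⁻¹)) g := by
      refine ContMDiffAt.comp (g := p) g ?_ hr
      rw [hgh]
      exact hp.contMDiffAt (hN.mem_nhds (hsN hv))
    refine (hq.congr_of_eventuallyEq ?_).contMDiffWithinAt
    have ev1 : ∀ᶠ x in 𝓝 g, x * h⁻¹ ∈ N :=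
      hr.continuousAt.preimage_mem_nhds (by rw [hgh]; exact hN.mem_nhds (hsN hv))
    have ev2 : ∀ᶠ x in 𝓝 g, p (x * h⁻¹) ∈ A :=
      hq.continuousAt.preimage_mem_nhds (by rw [hgh, hps v hv]; exact hA.mem_nhds hv)
    filter_upwards [ev1, ev2] with x hx1 hx2
    have hx : (x : G ⧸ H) = ψ (p (x * h⁻¹)) := by
      rw [hψ, hsp _ hx1]
      exact QuotientGroup.eq.2 (by simpa using H.inv_mem hh)
    rw [hx]
    exact ψ.left_inv hx2
  · exact hs

namespace IsClosedComplexLieSubgroup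

variable (hH : IsClosedComplexLieSubgroup E H)

/-- The model space of the complex manifold `G ⧸ H`: a complement in `E` of the tangent space
of `H` at the identity. -/
def model : Submodule ℂ E := hH.exists_chart.choose

/-- A holomorphic chart of `G ⧸ H` around the base point. -/
def baseChart : OpenPartialHomeomorph (G ⧸ H) hH.model := hH.exists_chart.choose_spec.choose

/-- A holomorphic lift to `G` of the inverse of the chart around the base point. -/
def baseSection : hH.model → G := hH.exists_chart.choose_spec.choose_spec.choose

theorem one_mem_baseChart_source : ((1 : G) : G ⧸ H) ∈ hH.baseChart.source :=
  hH.exists_chart.choose_spec.choose_spec.choose_spec.1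

theorem contMDiffOn_baseChart_mk :
    ContMDiffOn 𝓘(ℂ, E) 𝓘(ℂ, hH.model) ω (fun g : G => hH.baseChart (g : G ⧸ H))
      ((fun g : G => (g : G ⧸ H)) ⁻¹' hH.baseChart.source) :=
  hH.exists_chart.choose_spec.choose_spec.choose_spec.2.1

theorem contMDiffOn_baseSection :
    ContMDiffOn 𝓘(ℂ, hH.model) 𝓘(ℂ, E) ω hH.baseSection hH.baseChart.target :=
  hH.exists_chart.choose_spec.choose_spec.choose_spec.2.2.1

theorem baseChart_symm_eq {v : hH.model} (hv : v ∈ hH.baseChart.target) :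
    hH.baseChart.symm v = (hH.baseSection v : G ⧸ H) :=
  hH.exists_chart.choose_spec.choose_spec.choose_spec.2.2.2 v hv

/-- The translation of `G ⧸ H` by `g` as a homeomorphism. -/
def translate (H : Subgroup G) [IsTopologicalGroup G] (g : G) : (G ⧸ H) ≃ₜ (G ⧸ H) :=
  Homeomorph.smul g

/-- The translate by `g` of the chart around the base point, `x ↦ φ (g⁻¹ • x)`. -/
def chart (g : G) : OpenPartialHomeomorph (G ⧸ H) hH.model :=
  haveI : IsTopologicalGroup G := topologicalGroup_of_lieGroup 𝓘(ℂ, E) ω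
  (translate H g⁻¹).toOpenPartialHomeomorph.trans hH.baseChart

theorem chart_apply (g : G) (x : G ⧸ H) : hH.chart g x = hH.baseChart (g⁻¹ • x) := rfl

theorem mem_source_chart (g : G) (x : G ⧸ H) :
    x ∈ (hH.chart g).source ↔ g⁻¹ • x ∈ hH.baseChart.source := by
  simp [chart, translate]

theorem chart_target (g : G) : (hH.chart g).target = hH.baseChart.target := by
  simp [chart]

theorem chart_symm_apply (g : G) {v : hH.model} (hv : v ∈ hH.baseChart.target) :
    (hH.chart g).symm v = ((g * hH.baseSection v : G) : G ⧸ H) := by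
  have h : (hH.chart g).symm v = (g⁻¹)⁻¹ • hH.baseChart.symm v := rfl
  rw [h, hH.baseChart_symm_eq hv, inv_inv]
  rfl

/-- The holomorphic atlas of `G ⧸ H` (with the quotient topology) that consists of the translates
of the chart around the base point. -/
@[reducible]
def chartedSpace : ChartedSpace hH.model (G ⧸ H) where
  atlas := Set.range hH.chart
  chartAt x := hH.chart x.out
  mem_chart_source x := by
    rw [mem_source_chart]
    have h : x.out⁻¹ • x = ((1 : G) : G ⧸ H) := by
      conv_lhs => rw [← QuotientGroup.out_eq' x]
      change ((_ * _ : G) : G ⧸ H) = _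
      simp
    rw [h]
    exact hH.one_mem_baseChart_source
  chart_mem_atlas x := ⟨_, rfl⟩

/-- `G ⧸ H` is a complex manifold. -/
theorem isManifold :
    letI := hH.chartedSpace
    IsManifold 𝓘(ℂ, hH.model) ω (G ⧸ H) := by
  letI := hH.chartedSpace
  refine isManifold_of_contDiffOn _ _ _ ?_
  rintro _ _ ⟨g, rfl⟩ ⟨g', rfl⟩
  simp only [modelWithCornersSelf_coe, modelWithCornersSelf_coe_symm, Function.comp_id,
    Function.id_comp, Set.range_id, Set.inter_univ, Set.preimage_id]
  have key : ∀ v ∈ ((hH.chart g).symm ≫ₕ hH.chart g').source, v ∈ hH.baseChart.target ∧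
      ((g'⁻¹ * (g * hH.baseSection v) : G) : G ⧸ H) ∈ hH.baseChart.source := by
    intro v hv
    rw [OpenPartialHomeomorph.trans_source, OpenPartialHomeomorph.symm_source, chart_target] at hv
    refine ⟨hv.1, ?_⟩
    have h2 := hv.2
    rw [Set.mem_preimage, hH.chart_symm_apply g hv.1, mem_source_chart] at h2
    exact h2
  have hsm : ContMDiffOn 𝓘(ℂ, hH.model) 𝓘(ℂ, hH.model) ω
      (fun v => hH.baseChart ((g'⁻¹ * (g * hH.baseSection v) : G) : G ⧸ H))
      ((hH.chart g).symm ≫ₕ hH.chart g').source := by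
    refine hH.contMDiffOn_baseChart_mk.comp (f := fun v => g'⁻¹ * (g * hH.baseSection v)) ?_
      (fun v hv => (key v hv).2)
    exact contMDiffOn_const.mul (contMDiffOn_const.mul
      (hH.contMDiffOn_baseSection.mono fun v hv => (key v hv).1))
  refine (contMDiffOn_iff_contDiffOn.1 hsm).congr ?_
  intro v hv
  change hH.chart g' ((hH.chart g).symm v) = _
  rw [hH.chart_symm_apply g (key v hv).1]
  rfl

/-- The projection `G → G ⧸ H` is holomorphic. (It is a submersion, since it has the local
holomorphic sections `v ↦ g * hH.baseSection v` in the charts of `G ⧸ H`.) -/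
theorem contMDiff_mk :
    letI := hH.chartedSpace
    ContMDiff 𝓘(ℂ, E) 𝓘(ℂ, hH.model) ω (fun g : G => (g : G ⧸ H)) := by
  letI := hH.chartedSpace
  have : IsTopologicalGroup G := topologicalGroup_of_lieGroup 𝓘(ℂ, E) ω
  intro g
  rw [contMDiffAt_iff_target]
  refine ⟨QuotientGroup.continuous_mk.continuousAt, ?_⟩
  have hmem := mem_chart_source hH.model (g : G ⧸ H)
  set a : G := (g : G ⧸ H).out with ha
  change (g : G ⧸ H) ∈ (hH.chart a).source at hmem
  rw [hH.mem_source_chart] at hmem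
  have hopen : IsOpen ((fun g : G => (g : G ⧸ H)) ⁻¹' hH.baseChart.source) :=
    hH.baseChart.open_source.preimage QuotientGroup.continuous_mk
  have h1 := hH.contMDiffOn_baseChart_mk.contMDiffAt (x := a⁻¹ * g) (hopen.mem_nhds hmem)
  exact ContMDiffAt.comp (f := fun x : G => a⁻¹ * x) g h1
    (contMDiff_mul_left (a := a⁻¹)).contMDiffAt

end IsClosedComplexLieSubgroup

end Quotient

end

/-!
The isotropy group of the point `g H` of `X = G ⧸ H` is `g H g⁻¹`, and an injective `σ`-equivariant
map `μ` maps the isotropy group of `x` under `σ` onto that of `μ x`. At the base point this says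
that `σ H` is conjugate to `H`. If `H` is self-normalizing, a point of `X` is determined by its
isotropy group; hence `μ` is determined by `σ`, and any map `μ` of `X` that relates the isotropy
groups of `x` and `μ x` in this way is an involution. If `σ H = g H g⁻¹`, then `x H ↦ σ x g H` is
such a map; it is antiholomorphic because its composition with `G → X` is, and `G → X` has local
holomorphic sections.
-/

section SemiequivariantMap

open MulAction

variable {G G' X Y : Type*} [Group G] [Group G'] [MulAction G X] [MulAction G' Y] {σ : G →* G'}

theorem map_stabilizer_eq_of_injective (hσ : Function.Surjective σ) (μ : X →ₑ[σ] Y)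
    (hμ : Function.Injective μ) (x : X) :
    (stabilizer G x).map σ = stabilizer G' (μ x) := by
  have hcomap : stabilizer G x = (stabilizer G' (μ x)).comap σ := by
    ext g
    rw [Subgroup.mem_comap, mem_stabilizer_iff, mem_stabilizer_iff, ← map_smulₛₗ, hμ.eq_iff]
  rw [hcomap, Subgroup.map_comap_eq_self_of_surjective hσ]

theorem map_stabilizer_smul_eq (μ : X →ₑ[σ] Y) {x : X}
    (hx : (stabilizer G x).map σ = stabilizer G' (μ x)) (g : G) :
    (stabilizer G (g • x)).map σ = stabilizer G' (μ (g • x)) := by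
  have hconj : σ.comp (MulAut.conj g).toMonoidHom = (MulAut.conj (σ g)).toMonoidHom.comp σ := by
    ext
    simp
  rw [map_smulₛₗ, stabilizer_smul_eq_stabilizer_map_conj, stabilizer_smul_eq_stabilizer_map_conj,
    ← hx, Subgroup.map_map, Subgroup.map_map, hconj]

/-- The `σ`-equivariant map `G ⧸ H → Y` that sends the base point to `y`, that is,
`g H ↦ σ g • y`. It exists as soon as `σ H` fixes `y`. -/
def semiequivariantOrbitMap (H : Subgroup G) (y : Y) (hy : H.map σ ≤ stabilizer G' y) :
    G ⧸ H →ₑ[σ] Y where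
  toFun := Quotient.lift (fun g => σ g • y) fun a b hab => by
    have hfix : σ (a⁻¹ * b) • y = y :=
      hy (Subgroup.mem_map_of_mem σ (QuotientGroup.leftRel_apply.1 hab))
    rwa [map_mul, map_inv, mul_smul, inv_smul_eq_iff, eq_comm] at hfix
  map_smul' g x := by
    induction x using QuotientGroup.induction_on with
    | H a => exact (congrArg (· • y) (map_mul σ g a)).trans (mul_smul _ _ _)

variable {H : Subgroup G}

theorem semiequivariantOrbitMap_mk {y : Y} (hy : H.map σ ≤ stabilizer G' y) (g : G) :
    semiequivariantOrbitMap H y hy (g : G ⧸ H) = σ g • y := rfl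

theorem map_stabilizer_eq_semiequivariantOrbitMap {y : Y} (hy : H.map σ = stabilizer G' y)
    (x : G ⧸ H) :
    (stabilizer G x).map σ = stabilizer G' (semiequivariantOrbitMap H y hy.le x) := by
  obtain ⟨g, rfl⟩ := exists_smul_eq G ((1 : G) : G ⧸ H) x
  refine map_stabilizer_smul_eq _ ?_ g
  rw [stabilizer_quotient, semiequivariantOrbitMap_mk, map_one, one_smul, hy]

end SemiequivariantMap

section Isotropy

open MulAction

variable {G : Type*} [Group G] {H : Subgroup G}

theorem stabilizer_quotient_mk (g : G) :
    stabilizer G (g : G ⧸ H) = H.map (MulAut.conj g).toMonoidHom := by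
  have hg : (g : G ⧸ H) = g • ((1 : G) : G ⧸ H) := by
    rw [Quotient.smul_coe, smul_eq_mul, mul_one]
  rw [hg, stabilizer_smul_eq_stabilizer_map_conj, stabilizer_quotient]

theorem stabilizer_quotient_injective (hN : Subgroup.normalizer (H : Set G) = H) :
    Function.Injective (stabilizer G : G ⧸ H → Subgroup G) := by
  intro x y hxy
  obtain ⟨a, rfl⟩ := QuotientGroup.mk_surjective x
  obtain ⟨b, rfl⟩ := QuotientGroup.mk_surjective y
  rw [QuotientGroup.eq, ← hN, Subgroup.mem_normalizer_iff_map_conj_eq]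
  calc H.map (MulAut.conj (a⁻¹ * b)).toMonoidHom
      = stabilizer G (a⁻¹ • (b : G ⧸ H)) := (stabilizer_quotient_mk (a⁻¹ * b)).symm
    _ = (stabilizer G (b : G ⧸ H)).map (MulAut.conj a⁻¹).toMonoidHom :=
      stabilizer_smul_eq_stabilizer_map_conj _ _
    _ = (stabilizer G (a : G ⧸ H)).map (MulAut.conj a⁻¹).toMonoidHom := by rw [hxy]
    _ = stabilizer G (a⁻¹ • (a : G ⧸ H)) := (stabilizer_smul_eq_stabilizer_map_conj _ _).symm
    _ = H := by
      rw [Quotient.smul_coe, smul_eq_mul, inv_mul_cancel]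
      exact stabilizer_quotient H

theorem involutive_of_map_stabilizer_eq {X : Type*} [MulAction G X]
    (hX : Function.Injective (stabilizer G : X → Subgroup G)) {σ : G →* G}
    (hσ : Function.Involutive σ) {μ : X → X}
    (hμ : ∀ x, (stabilizer G x).map σ = stabilizer G (μ x)) : Function.Involutive μ := by
  intro x
  apply hX
  have hσσ : σ.comp σ = MonoidHom.id G := MonoidHom.ext hσ
  rw [← hμ, ← hμ, Subgroup.map_map, hσσ, Subgroup.map_id]

end Isotropy

namespace IsEquivariantRealStructure

open MulAction

variable {F : Type*} [NormedAddCommGroup F] [NormedSpace ℂ F] {G : Type*} [Group G] {σ : G →* G}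
  {X : Type*} [TopologicalSpace X] [ChartedSpace F X] [MulAction G X] {μ ν : X → X}

theorem map_stabilizer_eq (hσ : Function.Surjective σ) (hμ : IsEquivariantRealStructure F σ μ)
    (x : X) : (stabilizer G x).map σ = stabilizer G (μ x) :=
  map_stabilizer_eq_of_injective hσ ⟨μ, hμ.equivariant⟩ hμ.involutive.injective x

theorem eq_of_stabilizer_injective (hX : Function.Injective (stabilizer G : X → Subgroup G))
    (hσ : Function.Surjective σ) (hμ : IsEquivariantRealStructure F σ μ)
    (hν : IsEquivariantRealStructure F σ ν) : μ = ν :=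
  funext fun x => hX <| by rw [← hμ.map_stabilizer_eq hσ, hν.map_stabilizer_eq hσ]

end IsEquivariantRealStructure

section RestrictScalars

variable (𝕜 : Type*) {𝕜' : Type*} [NontriviallyNormedField 𝕜] [NontriviallyNormedField 𝕜']
  [NormedAlgebra 𝕜 𝕜']
  {E F : Type*} [NormedAddCommGroup E] [NormedSpace 𝕜 E] [NormedSpace 𝕜' E]
  [IsScalarTower 𝕜 𝕜' E] [NormedAddCommGroup F] [NormedSpace 𝕜 F] [NormedSpace 𝕜' F]
  [IsScalarTower 𝕜 𝕜' F]
  {M N : Type*} [TopologicalSpace M] [ChartedSpace E M] [TopologicalSpace N] [ChartedSpace F N]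
  {f : M → N} {x : M}

theorem contMDiffAt_restrictScalars {n : WithTop ℕ∞}
    (hf : ContMDiffAt 𝓘(𝕜', E) 𝓘(𝕜', F) n f x) : ContMDiffAt 𝓘(𝕜, E) 𝓘(𝕜, F) n f x := by
  rw [contMDiffAt_iff] at hf ⊢
  exact ⟨hf.1, hf.2.restrict_scalars 𝕜⟩

theorem hasMFDerivAt_restrictScalars {f' : E →L[𝕜'] F}
    (hf : HasMFDerivAt 𝓘(𝕜', E) 𝓘(𝕜', F) f x f') :
    HasMFDerivAt 𝓘(𝕜, E) 𝓘(𝕜, F) f x (f'.restrictScalars 𝕜) :=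
  ⟨hf.1, HasFDerivWithinAt.restrictScalars 𝕜 hf.2⟩

end RestrictScalars

section Antiholomorphic

variable {E E' F : Type*} [NormedAddCommGroup E] [NormedSpace ℂ E] [NormedAddCommGroup E']
  [NormedSpace ℂ E'] [NormedAddCommGroup F] [NormedSpace ℂ F]
  {M M' N : Type*} [TopologicalSpace M] [ChartedSpace E M] [TopologicalSpace M']
  [ChartedSpace E' M'] [TopologicalSpace N] [ChartedSpace F N]

theorem realDifferential_comp {g : M' → N} {f : M → M'} {x : M}
    (hg : MDifferentiableAt 𝓘(ℝ, E') 𝓘(ℝ, F) g (f x))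
    (hf : MDifferentiableAt 𝓘(ℝ, E) 𝓘(ℝ, E') f x) :
    realDifferential E F (g ∘ f) x =
      (realDifferential E' F g (f x)).comp (realDifferential E E' f x) :=
  mfderiv_comp x hg hf

theorem realDifferential_I_smul {f : M → N} {x : M}
    (hf : MDifferentiableAt 𝓘(ℂ, E) 𝓘(ℂ, F) f x) (v : E) :
    realDifferential E F f x (Complex.I • v) = Complex.I • realDifferential E F f x v := by
  let f' : E →L[ℂ] F := mfderiv 𝓘(ℂ, E) 𝓘(ℂ, F) f x
  have hf' : realDifferential E F f x = f'.restrictScalars ℝ :=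
    (hasMFDerivAt_restrictScalars ℝ hf.hasMFDerivAt).mfderiv
  rw [hf']
  exact f'.map_smul Complex.I v

variable (E F) in
/-- The pointwise version of `IsAntiholomorphic`: real smoothness at `x` and antilinearity of the
differential at `x`. It allows composing with maps that are only locally holomorphic. -/
def IsAntiholomorphicAt (f : M → N) (x : M) : Prop :=
  ContMDiffAt 𝓘(ℝ, E) 𝓘(ℝ, F) ∞ f x ∧
    ∀ v : E, realDifferential E F f x (Complex.I • v) =
      -(Complex.I • realDifferential E F f x v)

theorem isAntiholomorphic_iff_forall_isAntiholomorphicAt {f : M → N} :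
    IsAntiholomorphic E F f ↔ ∀ x, IsAntiholomorphicAt E F f x :=
  forall_and.symm

namespace IsAntiholomorphicAt

variable {x : M}

theorem congr_of_eventuallyEq {f g : M → N} (hf : IsAntiholomorphicAt E F f x)
    (hg : g =ᶠ[𝓝 x] f) : IsAntiholomorphicAt E F g x := by
  refine ⟨hf.1.congr_of_eventuallyEq hg, ?_⟩
  have hdiff : realDifferential E F g x = realDifferential E F f x := hg.mfderiv_eq
  rw [hdiff]
  exact hf.2

theorem comp_contMDiffAt {g : M' → N} {f : M → M'} (hg : IsAntiholomorphicAt E' F g (f x))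
    (hf : ContMDiffAt 𝓘(ℂ, E) 𝓘(ℂ, E') ∞ f x) : IsAntiholomorphicAt E F (g ∘ f) x := by
  have hf_real := contMDiffAt_restrictScalars ℝ hf
  refine ⟨hg.1.comp x hf_real, fun v => ?_⟩
  rw [realDifferential_comp (hg.1.mdifferentiableAt (by simp))
    (hf_real.mdifferentiableAt (by simp)), ContinuousLinearMap.comp_apply,
    realDifferential_I_smul (hf.mdifferentiableAt (by simp)), hg.2,
    ContinuousLinearMap.comp_apply]

theorem contMDiffAt_comp {g : M' → N} {f : M → M'} (hf : IsAntiholomorphicAt E E' f x)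
    (hg : ContMDiffAt 𝓘(ℂ, E') 𝓘(ℂ, F) ∞ g (f x)) :
    IsAntiholomorphicAt E F (g ∘ f) x := by
  have hg_real := contMDiffAt_restrictScalars ℝ hg
  refine ⟨hg_real.comp x hf.1, fun v => ?_⟩
  rw [realDifferential_comp (hg_real.mdifferentiableAt (by simp))
    (hf.1.mdifferentiableAt (by simp)), ContinuousLinearMap.comp_apply, hf.2, map_neg,
    realDifferential_I_smul (hg.mdifferentiableAt (by simp)), ContinuousLinearMap.comp_apply]

end IsAntiholomorphicAt

theorem IsAntiholomorphic.contMDiff_comp {g : M' → N} {f : M → M'}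
    (hf : IsAntiholomorphic E E' f) (hg : ContMDiff 𝓘(ℂ, E') 𝓘(ℂ, F) ∞ g) :
    IsAntiholomorphic E F (g ∘ f) := by
  rw [isAntiholomorphic_iff_forall_isAntiholomorphicAt] at hf ⊢
  exact fun x => (hf x).contMDiffAt_comp (hg (f x))

theorem IsAntiholomorphic.of_comp_of_exists_local_section {g : M' → N} {p : M → M'}
    (hgp : IsAntiholomorphic E F (g ∘ p))
    (hp : ∀ y, ∃ s : M' → M, ContMDiffAt 𝓘(ℂ, E') 𝓘(ℂ, E) ∞ s y ∧ ∀ᶠ z in 𝓝 y, p (s z) = z) :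
    IsAntiholomorphic E' F g := by
  rw [isAntiholomorphic_iff_forall_isAntiholomorphicAt] at hgp ⊢
  intro y
  obtain ⟨s, hs, hps⟩ := hp y
  refine ((hgp (s y)).comp_contMDiffAt hs).congr_of_eventuallyEq ?_
  filter_upwards [hps] with z hz
  exact (congrArg g hz).symm

end Antiholomorphic

namespace IsClosedComplexLieSubgroup

variable {E : Type*} [NormedAddCommGroup E] [NormedSpace ℂ E] [FiniteDimensional ℂ E]
  {G : Type*} [Group G] [TopologicalSpace G] [ChartedSpace E G] [LieGroup 𝓘(ℂ, E) ω G]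
  {H : Subgroup G}

theorem exists_local_section (hH : IsClosedComplexLieSubgroup E H) (x : G ⧸ H) :
    letI := hH.chartedSpace
    ∃ s : G ⧸ H → G, ContMDiffAt 𝓘(ℂ, hH.model) 𝓘(ℂ, E) ω s x ∧
      ∀ᶠ y in 𝓝 x, (s y : G ⧸ H) = y := by
  let := hH.chartedSpace
  have := hH.isManifold
  set φ := hH.chart x.out
  have hx : x ∈ φ.source := mem_chart_source hH.model x
  have hφ : ContMDiffAt 𝓘(ℂ, hH.model) 𝓘(ℂ, hH.model) ω φ x :=
    contMDiffOn_chart.contMDiffAt (φ.open_source.mem_nhds hx)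
  have hφ_target {y : G ⧸ H} (hy : y ∈ φ.source) : φ y ∈ hH.baseChart.target :=
    hH.chart_target x.out ▸ φ.map_source hy
  have hs : ContMDiffAt 𝓘(ℂ, hH.model) 𝓘(ℂ, E) ω hH.baseSection (φ x) :=
    hH.contMDiffOn_baseSection.contMDiffAt (hH.baseChart.open_target.mem_nhds (hφ_target hx))
  refine ⟨fun y => x.out * hH.baseSection (φ y), contMDiffAt_const.mul (hs.comp x hφ), ?_⟩
  filter_upwards [φ.open_source.mem_nhds hx] with y hy
  rw [← hH.chart_symm_apply _ (hφ_target hy), φ.left_inv hy]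

theorem isAntiholomorphic_semiequivariantOrbitMap (hH : IsClosedComplexLieSubgroup E H)
    {σ : G →* G} (hσ : IsAntiholomorphic E E σ) (y : G ⧸ H)
    (hy : H.map σ ≤ MulAction.stabilizer G y) :
    letI := hH.chartedSpace
    IsAntiholomorphic hH.model hH.model (semiequivariantOrbitMap H y hy) := by
  let := hH.chartedSpace
  obtain ⟨g, rfl⟩ := QuotientGroup.mk_surjective y
  refine IsAntiholomorphic.of_comp_of_exists_local_section (p := ((↑) : G → G ⧸ H)) ?_ fun x =>
    (hH.exists_local_section x).imp fun s hs => ⟨hs.1.of_le le_top, hs.2⟩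
  have horbit : ContMDiff 𝓘(ℂ, E) 𝓘(ℂ, hH.model) ω fun a : G => a • (g : G ⧸ H) :=
    hH.contMDiff_mk.comp contMDiff_mul_right
  exact hσ.contMDiff_comp (horbit.of_le le_top)

end IsClosedComplexLieSubgroup

theorem mainTheorem3
    {E : Type*} [NormedAddCommGroup E] [NormedSpace ℂ E] [FiniteDimensional ℂ E]
    {G : Type*} [Group G] [TopologicalSpace G] [ChartedSpace E G] [LieGroup 𝓘(ℂ, E) ω G]
    (σ : G →* G) (hσ : IsAntiholomorphic E E σ) (hσ_inv : Function.Involutive σ)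
    (H : Subgroup G) (hH : IsClosedComplexLieSubgroup E H) :
    letI := hH.chartedSpace
    ((∃ μ : G ⧸ H → G ⧸ H, IsEquivariantRealStructure hH.model σ μ) →
      ∃ g : G, H.map σ = H.map (MulAut.conj g).toMonoidHom) ∧
    ((∃ g : G, H.map σ = H.map (MulAut.conj g).toMonoidHom) →
      Subgroup.normalizer (H : Set G) = H →
      ∃! μ : G ⧸ H → G ⧸ H, IsEquivariantRealStructure hH.model σ μ) := by
  let := hH.chartedSpace
  refine ⟨fun ⟨μ, hμ⟩ => ?_, fun ⟨g, hg⟩ hN => ?_⟩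
  · obtain ⟨g, hg⟩ := QuotientGroup.mk_surjective (μ ((1 : G) : G ⧸ H))
    refine ⟨g, ?_⟩
    rw [← stabilizer_quotient_mk g, hg, ← hμ.map_stabilizer_eq hσ_inv.surjective,
      MulAction.stabilizer_quotient]
  · have hisotropy := stabilizer_quotient_injective hN
    rw [← stabilizer_quotient_mk g] at hg
    let μ := semiequivariantOrbitMap H (g : G ⧸ H) hg.le
    have hμ : IsEquivariantRealStructure hH.model σ μ :=
      { antiholomorphic := hH.isAntiholomorphic_semiequivariantOrbitMap hσ g hg.le
        involutive := involutive_of_map_stabilizer_eq hisotropy hσ_inv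
          (map_stabilizer_eq_semiequivariantOrbitMap hg)
        equivariant := map_smulₛₗ μ }
    exact ⟨μ, hμ, fun ν hν => hν.eq_of_stabilizer_injective hisotropy hσ_inv.surjective hμ⟩
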